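/- Circuits here are Boolean circuits (directed acyclic graphs) on $n$ inputs with AND, OR and XOR gates of unbounded fan-in over the literals $x_i,\neg x_i$. The size is the number of gates (literals are not counted), and the depth is the largest number of gates on a path to the output. A function $f\colon\mathbb F_2^n\to\mathbb F_2$ is an affine disperser for dimension $k$ if it is not constant on any affine subspace of $\mathbb F_2^n$ of dimension $k$. Let $k(m,d)$ be the largest $k$ such that every polynomial in $m$ variables over $\mathbb F_2$ of total degree at most $d$ is constant on some affine subspace of $\mathbb F_2^m$ of dimension $k$. In $k(\sqrt n/5,2c)$, and in "$\sqrt n/5$ variables", non-integers are rounded down. Let $c\ge 1$ be a real number, and let $C$ be a circuit on $n$ inputs, of depth at most $2$ and size at most $n^c$, which computes an affine disperser for dimension $k$. Then: (a) if $k<n/10-c\log_2 n$, there is a polynomial over $\mathbb F_2$ in $\sqrt n/5$ variables, of degree at most $2c$, which is an affine disperser for dimension $k$; (b) $k>k(\sqrt n/5,2c)$. Moreover, $k(\sqrt n/5,2c)=\Omega\bigl(n^{1/(4c)}\bigr)$: there are universal constants $\delta>0$ and $n_0$ such that $k(\sqrt n/5,2c)\ge\delta\, n^{1/(4c)}$ for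 all $n\ge n_0$ and all real $c\ge1$. -/

import Mathlib

/-- The function `f` is constant on the affine subspace `u₀ + U`. -/
def ConstOnCoset {F : Type*} [Field F] {n : ℕ} (f : (Fin n → F) → F)
    (u₀ : Fin n → F) (U : Submodule F (Fin n → F)) : Prop :=
  ∃ b : F, ∀ u ∈ U, f (u₀ + u) = b

/-- `f` is an affine disperser for dimension `k`: it is not constant on any affine subspace of
dimension `k`. -/
def IsAffineDisperser {F : Type*} [Field F] {n : ℕ} (f : (Fin n → F) → F) (k : ℕ) : Prop :=
  ∀ (u₀ : Fin n → F) (U : Submodule F (Fin n → F)), Module.finrank F U = k → ¬ ConstOnCoset f u₀ U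

/-- The dimensions `k` such that every polynomial in `n` variables over `F` of total degree at most
`d` is constant on some affine subspace of dimension `k`. -/
def constDims (F : Type*) [Field F] (n d : ℕ) : Set ℕ :=
  {k | ∀ p : MvPolynomial (Fin n) F, p.totalDegree ≤ d →
    ∃ (u₀ : Fin n → F) (U : Submodule F (Fin n → F)),
      Module.finrank F U = k ∧ ConstOnCoset (fun x => MvPolynomial.eval x p) u₀ U}

/-- The largest `k` such that every polynomial in `n` variables over `F` of total degree at most
`d` is constant on some affine subspace of dimension `k`. -/
noncomputable def maxConstDim (F : Type*) [Field F] (n d : ℕ) : ℕ :=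
  sSup (constDims F n d)

/-- The largest element exists, so that `maxConstDim` is really a maximum. -/
theorem maxConstDim_isGreatest (F : Type*) [Field F] (n d : ℕ) :
    IsGreatest (constDims F n d) (maxConstDim F n d) := by
  have hb : BddAbove (constDims F n d) := by
    refine ⟨n, fun k hk => ?_⟩
    obtain ⟨u₀, U, hU, -⟩ := hk 0 (by simp)
    rw [← hU]
    simpa using Submodule.finrank_le U
  have hne : (constDims F n d).Nonempty := by
    refine ⟨0, fun p _ => ⟨0, ⊥, by simp, MvPolynomial.eval 0 p, ?_⟩⟩
    intro u hu
    rw [Submodule.mem_bot] at hu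
    simp [hu]
  exact ⟨Nat.sSup_mem hne hb, fun k hk => le_csSup hb hk⟩

/-- The kinds of gates; all of them have unbounded fan-in. -/
inductive GateKind where
  | and
  | or
  | xor

/-- The value of a gate on the list of the values of its inputs. -/
def GateKind.eval : GateKind → List (ZMod 2) → ZMod 2
  | .and, l => if ∀ a ∈ l, a = 1 then 1 else 0
  | .or, l => if ∃ a ∈ l, a = 1 then 1 else 0
  | .xor, l => l.sum

/-- A wire of a circuit on `n` inputs starts at a literal `x_i` or `¬ x_i`, or at one of the gates
number `0, …, s - 1`. -/
inductive Wire (n s : ℕ) where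
  | pos (i : Fin n)
  | neg (i : Fin n)
  | gate (j : Fin s)

/-- A Boolean circuit on `n` inputs: a directed acyclic graph of AND, OR and XOR gates of unbounded
fan-in (and fan-out) over literals. The gates are numbered in a topological order, so that gate
number `i` reads literals and gates of smaller number only. The size is the number of gates;
literals are not counted. -/
structure ParityCircuit (n : ℕ) where
  size : ℕ
  kind : Fin size → GateKind
  inputs : (i : Fin size) → List (Wire n i.val)
  output : Wire n size

namespace ParityCircuit

variable {n : ℕ}

/-- The value that gate `i` computes on the input `x`. -/
def gateValue (C : ParityCircuit n) (x : Fin n → ZMod 2) (i : Fin C.size) : ZMod 2 :=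
  (C.kind i).eval ((C.inputs i).map fun w =>
    match w with
    | .pos v => x v
    | .neg v => 1 - x v
    | .gate j => C.gateValue x ⟨j.val, j.isLt.trans i.isLt⟩)
termination_by i.val
decreasing_by exact j.isLt

/-- The function `𝔽₂ⁿ → 𝔽₂` that the circuit computes. -/
def eval (C : ParityCircuit n) (x : Fin n → ZMod 2) : ZMod 2 :=
  match C.output with
  | .pos v => x v
  | .neg v => 1 - x v
  | .gate j => C.gateValue x j

/-- The depth of gate `i`: the largest number of gates on a path that ends in it. -/
def gateDepth (C : ParityCircuit n) (i : Fin C.size) : ℕ :=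
  1 + ((C.inputs i).map fun w =>
    match w with
    | .pos _ => 0
    | .neg _ => 0
    | .gate j => C.gateDepth ⟨j.val, j.isLt.trans i.isLt⟩).foldr max 0
termination_by i.val
decreasing_by exact j.isLt

/-- The depth of the circuit: the largest number of gates on a path to the output. -/
def depth (C : ParityCircuit n) : ℕ :=
  match C.output with
  | .pos _ => 0
  | .neg _ => 0
  | .gate j => C.gateDepth j

end ParityCircuit

/-!
Let `m = ⌊√n / 5⌋` and `d = ⌊2c⌋`. The core of the proof is that the circuit `C`, if it is a
disperser for a dimension `k ≤ m`, has degree at most `d` on some flat of dimension `m` (obtained by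
fixing all but `m` variables). The restriction of a disperser to a flat is a disperser, which
gives (a); and (b) follows, since a polynomial of degree at most `d` is constant on some flat of
dimension `k(m, d)`. If `m ≤ d` there is nothing to do, because every function of `m` variables has
degree at most `m`; if `k > m`, there is no flat of dimension `k` in `𝔽₂ᵐ` at all. In the remaining
case `2c < m`, so that the size of the circuit is below `2 ^ (n / 5)`, and the hypothesis on `k`
in (a) is not an additional restriction.

A gate that reads literals is an affine function or, up to a constant, the indicator function of a
subcube (`GateKind.eval_literals`).

* The output gate is not an AND or an OR, since the circuit would then be constant on a flat of
  dimension `k` (`ParityCircuit.exists_containsFlat_of_kind_ne_xor`). If some input of the gate has the controlling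
  value on such a flat, this is clear. Otherwise every input has the controlling value at no more
  than `2 ^ k` points, so one of the `2 ^ (n - k)` translates of a coordinate subspace avoids them
  all.
* If the output gate is an XOR, it suffices that the subcube indicators all have degree at most `d`
  after a suitable restriction. Choose `m` disjoint blocks of `q` variables, keep one random variable
  of each block alive, and fix all the other variables at random. An indicator that still depends
  on more than `d` variables has survived the fixing of the rest, and an exponential moment bound
  shows that this has probability at most `t ^ (-(d + 1))` whenever `2t ≤ q`
  (`card_badRestrictions_mul_le`). With `t > √n` a union bound over the gates finishes the argument
  (`exists_restriction`).

For the lower bound on `k(m, d)`, a flat `u₀ + U` on which a polynomial `p` of degree at most `d` is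
constant is enlarged one dimension at a time. That `p` takes the same value on `u₀ + v + U` amounts
to equations of degree at most `d` in `v`, one for each set of at most `d` basis vectors of `U`
(`HasPolyDegree.eq_of_small_sums`). On a complement of `U` they have the solution `v = 0`, hence
another one by the Chevalley-Warning theorem (`HasPolyDegree.exists_larger_flat`). This works up to
dimension `K` as long as `(2K) ^ d ≤ m`, which gives `k(m, d) ≥ m ^ (1 / d) / 4`.
-/

/-! ### Flats of prescribed dimension -/

/-- The set `S` contains an affine subspace of dimension `k`. -/
def ContainsFlat {F : Type*} [Field F] {n : ℕ} (S : Set (Fin n → F)) (k : ℕ) : Prop :=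
  ∃ (u₀ : Fin n → F) (U : Submodule F (Fin n → F)), Module.finrank F U = k ∧ ∀ u ∈ U, u₀ + u ∈ S

theorem ContainsFlat.mono {F : Type*} [Field F] {n k : ℕ} {S S' : Set (Fin n → F)}
    (h : ContainsFlat S k) (hS : S ⊆ S') : ContainsFlat S' k := by
  obtain ⟨u₀, U, hU, hu⟩ := h
  exact ⟨u₀, U, hU, fun u huU => hS (hu u huU)⟩

theorem IsAffineDisperser.not_containsFlat {F : Type*} [Field F] {n k : ℕ}
    {f : (Fin n → F) → F} (hf : IsAffineDisperser f k) (b : F) :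
    ¬ ContainsFlat {x | f x = b} k := by
  rintro ⟨u₀, U, hU, hu⟩
  exact hf u₀ U hU ⟨b, hu⟩

theorem IsAffineDisperser.of_lt {F : Type*} [Field F] {n k : ℕ} (h : n < k)
    (f : (Fin n → F) → F) : IsAffineDisperser f k := by
  intro u₀ U hU
  have := Submodule.finrank_le U
  rw [Module.finrank_fin_fun] at this
  omega

theorem exists_submodule_le_finrank_eq {F V : Type*} [Field F] [AddCommGroup V] [Module F V]
    [FiniteDimensional F V] (W : Submodule F V) {k : ℕ} (hk : k ≤ Module.finrank F W) :
    ∃ U ≤ W, Module.finrank F U = k := by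
  have hb := ((Module.finBasis F W).linearIndependent.comp _ (Fin.castLE_injective hk)).map'
    W.subtype W.ker_subtype
  refine ⟨_, ?_, (finrank_span_eq_card hb).trans (Fintype.card_fin k)⟩
  rw [Submodule.span_le]
  rintro _ ⟨i, rfl⟩
  exact Subtype.property _

/-- A fibre of a linear map into a space of dimension at most `n - k` contains a flat of
dimension `k`. -/
theorem containsFlat_fiber {F V : Type*} [Field F] [AddCommGroup V] [Module F V]
    [FiniteDimensional F V] {n k : ℕ} (φ : (Fin n → F) →ₗ[F] V) (x₀ : Fin n → F)
    (h : k + Module.finrank F V ≤ n) : ContainsFlat {x | φ x = φ x₀} k := by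
  have h1 := φ.finrank_range_add_finrank_ker
  rw [Module.finrank_fin_fun] at h1
  have h2 := Submodule.finrank_le (LinearMap.range φ)
  obtain ⟨U, hU, hk⟩ := exists_submodule_le_finrank_eq (LinearMap.ker φ) (k := k) (by omega)
  refine ⟨x₀, U, hk, fun u hu => ?_⟩
  have : φ u = 0 := hU hu
  simp [this]

/-- The points that take prescribed values on a set `T` of coordinates. -/
def subcube {n : ℕ} (T : Finset (Fin n)) (σ : Fin n → ZMod 2) : Finset (Fin n → ZMod 2) :=
  {x | ∀ i ∈ T, x i = σ i}

@[simp]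
theorem mem_subcube {n : ℕ} {T : Finset (Fin n)} {σ x : Fin n → ZMod 2} :
    x ∈ subcube T σ ↔ ∀ i ∈ T, x i = σ i := by
  simp [subcube]

theorem card_subcube {n : ℕ} (T : Finset (Fin n)) (σ : Fin n → ZMod 2) :
    (subcube T σ).card * 2 ^ T.card = 2 ^ n := by
  have : subcube T σ = Fintype.piFinset fun i => if i ∈ T then {σ i} else Finset.univ := by
    ext x
    simp only [mem_subcube, Fintype.mem_piFinset]
    refine forall_congr' fun i => ?_
    by_cases hi : i ∈ T <;> simp [hi]
  rw [this, Fintype.card_piFinset, ← Finset.prod_const, ← Finset.prod_ite_mem_eq T,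
    ← Finset.prod_mul_distrib]
  calc _ = ∏ i : Fin n, 2 := by
        refine Finset.prod_congr rfl fun i _ => ?_
        by_cases hi : i ∈ T <;> simp [hi, ZMod.card]
    _ = 2 ^ n := by simp

theorem containsFlat_subcube {n k : ℕ} (T : Finset (Fin n)) (σ : Fin n → ZMod 2)
    (h : k + T.card ≤ n) : ContainsFlat (subcube T σ : Set (Fin n → ZMod 2)) k := by
  refine (containsFlat_fiber (LinearMap.funLeft (ZMod 2) (ZMod 2) ((↑) : T → Fin n)) σ
    (by simpa using h)).mono fun x hx => ?_
  simp only [Finset.mem_coe, mem_subcube]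
  intro i hi
  exact congrFun hx ⟨i, hi⟩

/-- A set of fewer than `2 ^ (n - k)` points misses a flat of dimension `k`: it misses one of the
`2 ^ (n - k)` translates of a coordinate subspace of dimension `k`. -/
theorem containsFlat_compl {n k : ℕ} (hk : k ≤ n) (B : Finset (Fin n → ZMod 2))
    (hB : B.card < 2 ^ (n - k)) : ContainsFlat {x | x ∉ B} k := by
  obtain ⟨T, -, hT⟩ := Finset.exists_subset_card_eq
    (show n - k ≤ (Finset.univ : Finset (Fin n)).card by simp)
  let φ := LinearMap.funLeft (ZMod 2) (ZMod 2) ((↑) : T → Fin n)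
  have hlt : (B.image φ).card < (Finset.univ : Finset (T → ZMod 2)).card := by
    refine lt_of_le_of_lt Finset.card_image_le ?_
    simpa [ZMod.card, hT] using hB
  obtain ⟨z, -, hz⟩ := Finset.exists_mem_notMem_of_card_lt_card hlt
  obtain ⟨x₀, rfl⟩ := LinearMap.funLeft_surjective_of_injective (ZMod 2) (ZMod 2)
    ((↑) : T → Fin n) Subtype.val_injective z
  refine (containsFlat_fiber φ x₀ (by simp [hT]; omega)).mono fun x hx hxB => hz ?_
  exact Finset.mem_image.2 ⟨x, hxB, hx⟩

/-- A disperser stays one when all but an injective family of coordinates are fixed. -/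
theorem IsAffineDisperser.extend {F : Type*} [Field F] {n m k : ℕ} {f : (Fin n → F) → F}
    (hf : IsAffineDisperser f k) {a : Fin m → Fin n} (ha : Function.Injective a)
    (b : Fin n → F) : IsAffineDisperser (fun y => f (Function.extend a y b)) k := by
  rintro u₀ U hU ⟨c, hc⟩
  let φ := Function.ExtendByZero.linearMap F a
  have hφ : Function.Injective φ := Function.extend_injective ha 0
  refine hf (Function.extend a u₀ b) (U.map φ)
    ((LinearEquiv.finrank_eq (Submodule.equivMapOfInjective φ hφ U)).symm.trans hU) ⟨c, ?_⟩
  rintro _ ⟨u, hu, rfl⟩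
  rw [← hc u hu]
  congr 1
  ext i
  by_cases hi : ∃ j, a j = i
  · obtain ⟨j, rfl⟩ := hi
    simp [φ, ha.extend_apply]
  · simp [φ, Function.extend_apply' _ _ _ hi]

theorem zmod_two_eq_zero_or_one (a : ZMod 2) : a = 0 ∨ a = 1 := by
  decide +revert

/-! ### Functions given by polynomials of bounded degree -/

/-- The function `g` is given by a polynomial of total degree at most `d`. -/
def HasPolyDegree {F σ : Type*} [Field F] (d : ℕ) (g : (σ → F) → F) : Prop :=
  ∃ p : MvPolynomial σ F, p.totalDegree ≤ d ∧ ∀ x, MvPolynomial.eval x p = g x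

namespace HasPolyDegree

variable {F σ τ : Type*} [Field F] {d d' : ℕ} {g g' : (σ → F) → F}

theorem mono (h : HasPolyDegree d g) (hd : d ≤ d') : HasPolyDegree d' g := by
  obtain ⟨p, hp, hpg⟩ := h
  exact ⟨p, hp.trans hd, hpg⟩

theorem const (d : ℕ) (a : F) : HasPolyDegree d (fun _ : σ → F => a) :=
  ⟨MvPolynomial.C a, by simp, by simp⟩

theorem coord (i : σ) : HasPolyDegree 1 (fun x : σ → F => x i) :=
  ⟨MvPolynomial.X i, by simp, by simp⟩

theorem add (h : HasPolyDegree d g) (h' : HasPolyDegree d g') :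
    HasPolyDegree d (fun x => g x + g' x) := by
  obtain ⟨p, hp, hpg⟩ := h
  obtain ⟨p', hp', hpg'⟩ := h'
  exact ⟨p + p', (MvPolynomial.totalDegree_add _ _).trans (max_le hp hp'), by simp [hpg, hpg']⟩

theorem mul (h : HasPolyDegree d g) (h' : HasPolyDegree d' g') :
    HasPolyDegree (d + d') (fun x => g x * g' x) := by
  obtain ⟨p, hp, hpg⟩ := h
  obtain ⟨p', hp', hpg'⟩ := h'
  exact ⟨p * p', (MvPolynomial.totalDegree_mul _ _).trans (add_le_add hp hp'),
    by simp [hpg, hpg']⟩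

theorem sum {ι : Type*} (s : Finset ι) {G : ι → (σ → F) → F}
    (h : ∀ i ∈ s, HasPolyDegree d (G i)) : HasPolyDegree d (fun x => ∑ i ∈ s, G i x) := by
  classical
  induction s using Finset.induction_on with
  | empty => simpa using const d (0 : F)
  | insert a s ha ih =>
    simp only [Finset.sum_insert ha]
    exact (h a (by simp)).add (ih fun i hi => h i (by simp [hi]))

theorem prod {ι : Type*} (s : Finset ι) {G : ι → (σ → F) → F} {D : ι → ℕ}
    (h : ∀ i ∈ s, HasPolyDegree (D i) (G i)) :
    HasPolyDegree (∑ i ∈ s, D i) (fun x => ∏ i ∈ s, G i x) := by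
  classical
  induction s using Finset.induction_on with
  | empty => simpa using const 0 (1 : F)
  | insert a s ha ih =>
    simp only [Finset.prod_insert ha, Finset.sum_insert ha]
    exact (h a (by simp)).mul (ih fun i hi => h i (by simp [hi]))

theorem list_sum {ι : Type*} (l : List ι) {G : ι → (σ → F) → F}
    (h : ∀ i ∈ l, HasPolyDegree d (G i)) :
    HasPolyDegree d (fun x => (l.map fun i => G i x).sum) := by
  induction l with
  | nil => simpa using const d (0 : F)
  | cons a l ih =>
    simp only [List.map_cons, List.sum_cons]
    exact (h a (by simp)).add (ih fun i hi => h i (by simp [hi]))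

/-- Substituting functions of degree at most `1` does not increase the degree. -/
theorem comp (h : HasPolyDegree d g) {A : (τ → F) → σ → F}
    (hA : ∀ i, HasPolyDegree 1 (fun y => A y i)) : HasPolyDegree d (fun y => g (A y)) := by
  obtain ⟨p, hp, hpg⟩ := h
  have : ∀ y, g (A y) =
      ∑ e ∈ p.support, p.coeff e * ∏ i ∈ e.support, ∏ _j ∈ Finset.range (e i), A y i := by
    intro y
    rw [← hpg, MvPolynomial.eval_eq]
    simp
  simp only [this]
  refine sum _ fun e he => ?_
  refine (((const 0 _).mul (prod _ fun i _ => prod (Finset.range (e i)) fun _ _ => hA i))).mono ?_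
  have := MvPolynomial.le_totalDegree he
  simp only [Finsupp.sum] at this
  simpa using this.trans hp

end HasPolyDegree

/-- Every function on `𝔽₂ᵐ` is given by a multilinear polynomial. -/
theorem hasPolyDegree_card {m : ℕ} (g : (Fin m → ZMod 2) → ZMod 2) : HasPolyDegree m g := by
  have h : g ∈ (⊤ : Submodule (ZMod 2) _) := Submodule.mem_top
  rw [← MvPolynomial.map_restrict_dom_evalₗ] at h
  obtain ⟨p, hp, rfl⟩ := h
  refine ⟨p, ?_, fun x => rfl⟩
  refine Finset.sup_le fun e he => ?_
  rw [Finsupp.sum_fintype _ _ fun _ => rfl]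
  calc ∑ i, e i ≤ ∑ _i : Fin m, 1 := Finset.sum_le_sum fun i _ => by
        simpa [ZMod.card] using (MvPolynomial.mem_restrictDegree _ _ _).1 hp e he i
    _ = m := by simp

/-! ### Low-degree polynomials are constant on large flats -/

/-- If a function of degree at most `d` takes one value at all sums of at most `d` of the vectors
`u i`, then it takes that value at all sums of the `u i`. The reason is that a function of degree
less than `s` sums to zero over a cube of dimension `s`, so the value at the top vertex is
determined by the other vertices. -/
theorem HasPolyDegree.eq_of_small_sums {V : Type*} {n d : ℕ} {g : (Fin n → ZMod 2) → ZMod 2}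
    (hg : HasPolyDegree d g) (x : Fin n → ZMod 2) (u : V → Fin n → ZMod 2) (b : ZMod 2)
    (h : ∀ S : Finset V, S.card ≤ d → g (x + ∑ i ∈ S, u i) = b) (S : Finset V) :
    g (x + ∑ i ∈ S, u i) = b := by
  classical
  induction S using Finset.strongInduction with
  | H S ih =>
  rcases le_or_gt S.card d with hS | hS
  · exact h S hS
  have hcomp : HasPolyDegree d fun z : S → ZMod 2 => g (x + ∑ i : S, z i • u i) := by
    refine hg.comp fun j => ?_
    simp only [Pi.add_apply, Finset.sum_apply, Pi.smul_apply, smul_eq_mul]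
    exact (HasPolyDegree.const 1 _).add (.sum _ fun i _ =>
      (HasPolyDegree.coord i).mul (.const 0 _))
  obtain ⟨p, hp, hpg⟩ := hcomp
  have hsum := MvPolynomial.sum_eval_eq_zero p (by simpa [ZMod.card] using hp.trans_lt hS)
  -- The points of the cube correspond to the subsets of `S`.
  have hval : ∀ z : S → ZMod 2, z ≠ 1 → MvPolynomial.eval z p = b := by
    intro z hz
    rw [hpg]
    let R : Finset V := ({i : S | z i = 1} : Finset S).map (Function.Embedding.subtype _)
    have hR : ∑ i : S, z i • u i = ∑ i ∈ R, u i := by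
      rw [Finset.sum_map, Finset.sum_filter]
      refine Finset.sum_congr rfl fun i _ => ?_
      rcases zmod_two_eq_zero_or_one (z i) with hi | hi <;> simp [hi]
    simp only [hR]
    apply ih
    refine Finset.ssubset_iff_subset_ne.2 ⟨?_, ?_⟩
    · intro i hi
      simp only [R, Finset.mem_map] at hi
      obtain ⟨j, -, rfl⟩ := hi
      exact j.2
    · intro hRS
      apply hz
      ext i
      have : (i : V) ∈ R := by rw [hRS]; exact i.2
      simpa [R] using this
  have htop : MvPolynomial.eval 1 p = g (x + ∑ i ∈ S, u i) := by
    rw [hpg]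
    simp only [Pi.one_apply, one_smul, Finset.sum_coe_sort S u]
  have hconst : ∑ z : S → ZMod 2, (MvPolynomial.eval z p + b) = 0 := by
    rw [Finset.sum_add_distrib, hsum, Finset.sum_const, Finset.card_univ, Fintype.card_fun,
      ZMod.card, Fintype.card_coe, nsmul_eq_mul]
    have : S.card ≠ 0 := by omega
    have h2 : ((2 : ℕ) : ZMod 2) = 0 := rfl
    rw [Nat.cast_pow, h2, zero_pow this]
    simp
  rw [Finset.sum_eq_single 1 (fun z _ hz => by rw [hval z hz]; exact CharTwo.add_self_eq_zero b)
    (by simp), htop] at hconst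
  exact CharTwo.add_eq_zero.1 hconst

/-- One step of the construction of a flat: by the Chevalley-Warning theorem there is a vector `v`
outside `U` such that `g` takes the value `b` on `u₀ + v + U` too. -/
theorem HasPolyDegree.exists_larger_flat {n d k : ℕ} {g : (Fin n → ZMod 2) → ZMod 2}
    (hg : HasPolyDegree d g) {u₀ : Fin n → ZMod 2} {U : Submodule (ZMod 2) (Fin n → ZMod 2)}
    (hU : Module.finrank (ZMod 2) U = k) {b : ZMod 2} (hb : ∀ u ∈ U, g (u₀ + u) = b)
    (hn : (k + 1) ^ d * d + k < n) :
    ∃ U' : Submodule (ZMod 2) (Fin n → ZMod 2), Module.finrank (ZMod 2) U' = k + 1 ∧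
      ∀ u ∈ U', g (u₀ + u) = b := by
  classical
  obtain ⟨W, hW⟩ := Submodule.exists_isCompl U
  have hWdim := Submodule.finrank_add_eq_of_isCompl hW
  rw [Module.finrank_fin_fun, hU] at hWdim
  let u := Module.finBasisOfFinrankEq (ZMod 2) U hU
  let w := Module.finBasis (ZMod 2) W
  -- The sets of at most `d` basis vectors of `U` are the images of maps `Fin d → Option (Fin k)`.
  let S : (Fin d → Option (Fin k)) → Finset (Fin k) := fun τ => {i | ∃ j, τ j = some i}
  have hS : ∀ R : Finset (Fin k), R.card ≤ d → ∃ τ, S τ = R := by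
    intro R hR
    refine ⟨fun j => if h : (j : ℕ) < R.card then some (R.equivFin.symm ⟨j, h⟩) else none, ?_⟩
    ext i
    simp only [S, Finset.mem_filter, Finset.mem_univ, true_and]
    constructor
    · rintro ⟨j, hj⟩
      split_ifs at hj with h
      rw [← Option.some.inj hj]
      exact Subtype.property _
    · intro hi
      refine ⟨⟨R.equivFin ⟨i, hi⟩, (Fin.is_lt _).trans_le hR⟩, ?_⟩
      simp
  let A : (Fin (Module.finrank (ZMod 2) W) → ZMod 2) → Fin n → ZMod 2 :=
    fun z => ∑ l, z l • (w l : Fin n → ZMod 2)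
  have hpoly : ∀ τ, HasPolyDegree d fun z => g (u₀ + A z + ∑ i ∈ S τ, (u i : Fin n → ZMod 2)) + b := by
    intro τ
    refine HasPolyDegree.add (hg.comp fun j => ?_) (.const d b)
    simp only [A, Pi.add_apply, Finset.sum_apply, Pi.smul_apply, smul_eq_mul]
    exact ((HasPolyDegree.const 1 _).add (.sum _ fun i _ =>
      (HasPolyDegree.coord i).mul (.const 0 _))).add (.const 1 _)
  choose P hP hPeval using hpoly
  have hdvd := char_dvd_card_solutions_of_fintype_sum_lt (K := ZMod 2) 2 (f := P) (by
    refine (Finset.sum_le_sum fun τ _ => hP τ).trans_lt ?_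
    simp
    omega)
  have hmem : ∀ i, (u i : Fin n → ZMod 2) ∈ U := fun i => (u i).2
  -- The zero vector solves the system, so there is a second solution.
  have h0 : ∀ τ, MvPolynomial.eval 0 (P τ) = 0 := by
    intro τ
    rw [hPeval]
    simp only [A, Pi.zero_apply, zero_smul, Finset.sum_const_zero, add_zero]
    rw [hb _ (U.sum_mem fun i _ => hmem i)]
    exact CharTwo.add_self_eq_zero b
  have hcard : 1 < Fintype.card {x // ∀ τ, MvPolynomial.eval x (P τ) = 0} := by
    have : Nonempty {x // ∀ τ, MvPolynomial.eval x (P τ) = 0} := ⟨⟨0, h0⟩⟩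
    have := Nat.le_of_dvd Fintype.card_pos hdvd
    omega
  obtain ⟨⟨z, hz⟩, hz0⟩ := Fintype.exists_ne_of_one_lt_card hcard ⟨0, h0⟩
  have hz0 : z ≠ 0 := fun h => hz0 (Subtype.ext h)
  let v : W := ∑ l, z l • w l
  have hv : A z = v := by simp [A, v]
  have hv0 : v ≠ 0 := by
    intro h
    apply hz0
    ext l
    exact Fintype.linearIndependent_iff.1 w.linearIndependent z h l
  have hvU : A z ∉ U := by
    intro h
    apply hv0
    have : (v : Fin n → ZMod 2) = 0 :=
      (Submodule.disjoint_def.1 hW.disjoint) _ (hv ▸ h) v.2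
    exact Subtype.ext this
  have hall : ∀ x ∈ U, g (u₀ + A z + x) = b := by
    intro x hx
    have hx' : x = ∑ i ∈ ({i | u.repr ⟨x, hx⟩ i = 1} : Finset (Fin k)),
        (u i : Fin n → ZMod 2) := by
      conv_lhs => rw [show x = ((⟨x, hx⟩ : U) : Fin n → ZMod 2) from rfl, ← u.sum_repr ⟨x, hx⟩]
      rw [Finset.sum_filter, Submodule.coe_sum]
      refine Finset.sum_congr rfl fun i _ => ?_
      rw [Submodule.coe_smul]
      generalize u.repr ⟨x, hx⟩ i = a
      rcases zmod_two_eq_zero_or_one a with rfl | rfl <;> simp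
    rw [hx']
    refine hg.eq_of_small_sums _ _ b (fun R hR => ?_) _
    obtain ⟨τ, rfl⟩ := hS R hR
    have := hz τ
    rw [hPeval] at this
    exact CharTwo.add_eq_zero.1 this
  refine ⟨U ⊔ Submodule.span (ZMod 2) {A z}, ?_, ?_⟩
  · have h1 := Submodule.finrank_sup_add_finrank_inf_eq U (Submodule.span (ZMod 2) {A z})
    have h2 : U ⊓ Submodule.span (ZMod 2) {A z} = ⊥ := by
      rw [← disjoint_iff, Submodule.disjoint_span_singleton]
      exact fun h => absurd h hvU
    have h3 : A z ≠ 0 := fun h => hvU (h ▸ U.zero_mem)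
    rw [h2, finrank_bot, finrank_span_singleton h3, hU] at h1
    simpa using h1
  · intro y hy
    obtain ⟨x, hx, t, ht, rfl⟩ := Submodule.mem_sup.1 hy
    obtain ⟨c, rfl⟩ := Submodule.mem_span_singleton.1 ht
    rcases zmod_two_eq_zero_or_one c with rfl | rfl
    · simpa using hb x hx
    · rw [one_smul, add_comm x, ← add_assoc]
      exact hall x hx

/-- Iterating the previous step: `(2K) ^ d` variables suffice for dimension `K`. -/
theorem mem_constDims_of_pow_le {m d K : ℕ} (hd : 1 ≤ d) (h : (2 * K) ^ d ≤ m) :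
    K ∈ constDims (ZMod 2) m d := by
  intro p hp
  have hg : HasPolyDegree d fun x => MvPolynomial.eval x p := ⟨p, hp, fun _ => rfl⟩
  have key : ∀ k ≤ K, ∃ U : Submodule (ZMod 2) (Fin m → ZMod 2),
      Module.finrank (ZMod 2) U = k ∧
        ∀ u ∈ U, MvPolynomial.eval (0 + u) p = MvPolynomial.eval 0 p := by
    intro k
    induction k with
    | zero =>
      refine fun _ => ⟨⊥, by simp, fun u hu => ?_⟩
      rw [(Submodule.mem_bot _).1 hu, add_zero]
    | succ k ih =>
      intro hk
      obtain ⟨U, hU, hb⟩ := ih (by omega)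
      refine hg.exists_larger_flat hU hb ?_
      have h1 : (2 * (k + 1)) ^ d ≤ m := (Nat.pow_le_pow_left (by omega) d).trans h
      rw [mul_pow] at h1
      have h2 : d + 1 ≤ 2 ^ d := Nat.lt_two_pow_self
      have h3 : k + 1 ≤ (k + 1) ^ d := Nat.le_self_pow (by omega) _
      nlinarith [Nat.mul_le_mul_right ((k + 1) ^ d) h2]
  obtain ⟨U, hU, hb⟩ := key K le_rfl
  exact ⟨0, U, hU, _, hb⟩

/-- Two of any three points of `𝔽₂ᵐ` have the same image in `𝔽₂`, and two points form a flat. -/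
theorem one_mem_constDims {m d : ℕ} (hm : 2 ≤ m) : 1 ∈ constDims (ZMod 2) m d := by
  intro p _
  obtain ⟨x, y, hxy, he⟩ := Fintype.exists_ne_map_eq_of_card_lt
    (fun x : Fin m → ZMod 2 => MvPolynomial.eval x p) (by
      simpa [ZMod.card] using (Nat.pow_lt_pow_right one_lt_two hm).trans_le' (by norm_num))
  refine ⟨x, Submodule.span (ZMod 2) {y - x}, finrank_span_singleton (sub_ne_zero.2 hxy.symm),
    MvPolynomial.eval x p, fun u hu => ?_⟩
  obtain ⟨c, rfl⟩ := Submodule.mem_span_singleton.1 hu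
  rcases zmod_two_eq_zero_or_one c with rfl | rfl
  · simp
  · simpa using he.symm

theorem rpow_le_maxConstDim {m d : ℕ} (hd : 1 ≤ d) (hm : 2 ≤ m) :
    (m : ℝ) ^ (1 / (d : ℝ)) / 4 ≤ maxConstDim (ZMod 2) m d := by
  have hle : ∀ K ∈ constDims (ZMod 2) m d, K ≤ maxConstDim (ZMod 2) m d :=
    fun K hK => (maxConstDim_isGreatest (ZMod 2) m d).2 hK
  set y := (m : ℝ) ^ (1 / (d : ℝ)) with hy
  have hy0 : 0 ≤ y := by positivity
  have hyd : y ^ d = m := by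
    rw [hy, one_div, Real.rpow_inv_natCast_pow (by positivity) (by omega)]
  have h1 : (1 : ℝ) ≤ maxConstDim (ZMod 2) m d := by exact_mod_cast hle 1 (one_mem_constDims hm)
  have h2 : (⌊y / 2⌋₊ : ℝ) ≤ maxConstDim (ZMod 2) m d := by
    refine Nat.cast_le.2 (hle _ (mem_constDims_of_pow_le hd ?_))
    have : (2 * (⌊y / 2⌋₊ : ℝ)) ^ d ≤ m := by
      rw [← hyd]
      refine pow_le_pow_left₀ (by positivity) ?_ d
      linarith [Nat.floor_le (show 0 ≤ y / 2 by positivity)]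
    exact_mod_cast this
  linarith [Nat.lt_floor_add_one (y / 2)]

/-! ### The functions computed by gates that read literals -/

/-- `g` is a constant plus the indicator function of a subcube: the form of an AND (constant `0`)
or an OR (constant `1`) of literals. -/
def IsSubcubeIndicator {n : ℕ} (g : (Fin n → ZMod 2) → ZMod 2) : Prop :=
  ∃ (T : Finset (Fin n)) (σ : Fin n → ZMod 2) (a : ZMod 2),
    ∀ x, g x = a + if x ∈ subcube T σ then 1 else 0

/-- The value on `x` of the literal `l`, which is encoded as a variable and a bit to add to it. -/
def literalValue {n : ℕ} (x : Fin n → ZMod 2) (l : Fin n × ZMod 2) : ZMod 2 :=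
  x l.1 + l.2

/-- `g` is a linear functional plus a constant: the form of an XOR of literals. -/
def IsAffineFunction {n : ℕ} (g : (Fin n → ZMod 2) → ZMod 2) : Prop :=
  ∃ (φ : (Fin n → ZMod 2) →ₗ[ZMod 2] ZMod 2) (a : ZMod 2), ∀ x, g x = φ x + a

theorem isAffineFunction_const {n : ℕ} (a : ZMod 2) :
    IsAffineFunction fun _ : Fin n → ZMod 2 => a :=
  ⟨0, a, by simp⟩

theorem isAffineFunction_literalValue {n : ℕ} (l : Fin n × ZMod 2) :
    IsAffineFunction fun x : Fin n → ZMod 2 => literalValue x l :=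
  ⟨LinearMap.proj l.1, l.2, fun _ => rfl⟩

theorem IsAffineFunction.add {n : ℕ} {g g' : (Fin n → ZMod 2) → ZMod 2}
    (h : IsAffineFunction g) (h' : IsAffineFunction g') :
    IsAffineFunction fun x => g x + g' x := by
  obtain ⟨φ, a, h⟩ := h
  obtain ⟨φ', a', h'⟩ := h'
  exact ⟨φ + φ', a + a', fun x => by simp only [h, h', LinearMap.add_apply]; ring⟩

theorem IsAffineFunction.hasPolyDegree {n : ℕ} {g : (Fin n → ZMod 2) → ZMod 2}
    (h : IsAffineFunction g) : HasPolyDegree 1 g := by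
  obtain ⟨φ, a, h⟩ := h
  have : g = fun x => ∑ i, x i * φ (fun j => if i = j then 1 else 0) + a := by
    funext x
    rw [h, LinearMap.pi_apply_eq_sum_univ φ x]
    rfl
  rw [this]
  exact (HasPolyDegree.sum _ fun i _ => (HasPolyDegree.coord i).mul (.const 0 _)).add (.const 1 a)

/-- A conjunction of literals that has a satisfying assignment `σ` is the indicator function of the
subcube of the points that agree with `σ` on the variables that occur. -/
theorem exists_subcube_forall_literal {n : ℕ} (L : List (Fin n × ZMod 2)) (b : ZMod 2)
    {σ : Fin n → ZMod 2} (hσ : ∀ l ∈ L, literalValue σ l = b) (x : Fin n → ZMod 2) :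
    (∀ l ∈ L, literalValue x l = b) ↔ x ∈ subcube (L.map Prod.fst).toFinset σ := by
  have key : ∀ l ∈ L, literalValue x l = b ↔ x l.1 = σ l.1 := by
    intro l hl
    rw [← hσ l hl]
    exact add_left_inj l.2
  simp only [mem_subcube, List.mem_toFinset, List.mem_map]
  constructor
  · rintro h _ ⟨l, hl, rfl⟩
    exact (key l hl).1 (h l hl)
  · exact fun h l hl => (key l hl).2 (h _ ⟨l, hl, rfl⟩)

/-- A gate that reads literals computes an affine function or, up to a constant, the indicator
function of a subcube. -/
theorem GateKind.eval_literals {n : ℕ} (K : GateKind) (L : List (Fin n × ZMod 2)) :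
    IsAffineFunction (fun x => K.eval (L.map (literalValue x))) ∨
      IsSubcubeIndicator (fun x => K.eval (L.map (literalValue x))) := by
  cases K with
  | xor =>
    refine Or.inl ?_
    simp only [GateKind.eval]
    induction L with
    | nil => exact isAffineFunction_const 0
    | cons l L ih => exact (isAffineFunction_literalValue l).add ih
  | and =>
    by_cases h : ∃ σ : Fin n → ZMod 2, ∀ l ∈ L, literalValue σ l = 1
    · obtain ⟨σ, hσ⟩ := h
      refine Or.inr ⟨(L.map Prod.fst).toFinset, σ, 0, fun x => ?_⟩
      simp only [GateKind.eval, List.forall_mem_map, exists_subcube_forall_literal L 1 hσ, zero_add]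
    · refine Or.inl ?_
      have : ∀ x : Fin n → ZMod 2, ¬ ∀ l ∈ L, literalValue x l = 1 := fun x hx => h ⟨x, hx⟩
      simp only [GateKind.eval, List.forall_mem_map, this, if_false]
      exact isAffineFunction_const 0
  | or =>
    have hor : ∀ x : Fin n → ZMod 2, GateKind.or.eval (L.map (literalValue x)) =
        1 + if ∀ l ∈ L, literalValue x l = 0 then 1 else 0 := by
      intro x
      simp only [GateKind.eval, List.mem_map, exists_exists_and_eq_and]
      by_cases h : ∀ l ∈ L, literalValue x l = 0
      · rw [if_pos h, if_neg]
        · rfl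
        · rintro ⟨l, hl, h1⟩
          rw [h l hl] at h1
          exact zero_ne_one h1
      · rw [if_neg h, if_pos, add_zero]
        push Not at h
        obtain ⟨l, hl, h1⟩ := h
        exact ⟨l, hl, (zmod_two_eq_zero_or_one _).resolve_left h1⟩
    simp only [hor]
    by_cases h : ∃ σ : Fin n → ZMod 2, ∀ l ∈ L, literalValue σ l = 0
    · obtain ⟨σ, hσ⟩ := h
      refine Or.inr ⟨(L.map Prod.fst).toFinset, σ, 1, fun x => ?_⟩
      simp only [exists_subcube_forall_literal L 0 hσ]
    · refine Or.inl ?_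
      have : ∀ x : Fin n → ZMod 2, ¬ ∀ l ∈ L, literalValue x l = 0 := fun x hx => h ⟨x, hx⟩
      simp only [this, if_false]
      exact isAffineFunction_const _

/-- The controlling value `b` of an AND or OR gate (`0` for AND, `1` for OR): the gate outputs `b` if
and only if some input is `b`. -/
theorem GateKind.eval_of_controlling {K : GateKind} (hK : K ≠ .xor) :
    ∃ b : ZMod 2, (∀ l : List (ZMod 2), b ∈ l → K.eval l = b) ∧
      ∀ l : List (ZMod 2), b ∉ l → K.eval l = b + 1 := by
  have h01 : ∀ a : ZMod 2, a ≠ 1 → a = 0 := fun a h =>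
    (zmod_two_eq_zero_or_one a).resolve_right h
  cases K with
  | xor => exact absurd rfl hK
  | and =>
    refine ⟨0, fun l h => if_neg fun h1 => zero_ne_one (h1 0 h), fun l h => ?_⟩
    rw [zero_add]
    refine if_pos fun a ha => by_contra fun h1 => h ?_
    rwa [← h01 a h1]
  | or =>
    refine ⟨1, fun l h => if_pos ⟨1, h, rfl⟩, fun l h => ?_⟩
    have : (1 : ZMod 2) + 1 = 0 := rfl
    rw [this]
    refine if_neg ?_
    rintro ⟨a, ha, rfl⟩
    exact h ha

/-! ### Circuits of depth two -/

theorem le_foldr_max {l : List ℕ} {a : ℕ} (h : a ∈ l) : a ≤ l.foldr max 0 := by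
  induction l with
  | nil => simp at h
  | cons b l ih =>
    rcases List.mem_cons.1 h with rfl | h
    · exact le_max_left _ _
    · exact (ih h).trans (le_max_right _ _)

namespace ParityCircuit

variable {n : ℕ} (C : ParityCircuit n)

/-- The value on `x` of a wire into gate `i`. -/
def wireValue {C : ParityCircuit n} {i : Fin C.size} (x : Fin n → ZMod 2) : Wire n i.val → ZMod 2
  | .pos v => x v
  | .neg v => 1 - x v
  | .gate j => C.gateValue x ⟨j.val, j.isLt.trans i.isLt⟩

theorem gateValue_eq (x : Fin n → ZMod 2) (i : Fin C.size) :
    C.gateValue x i = (C.kind i).eval ((C.inputs i).map (wireValue x)) := by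
  rw [gateValue]
  congr 2

theorem one_le_gateDepth (i : Fin C.size) : 1 ≤ C.gateDepth i := by
  rw [gateDepth]
  exact Nat.le_add_right _ _

theorem gateDepth_lt {i : Fin C.size} {j : Fin i.val} (h : Wire.gate j ∈ C.inputs i) :
    C.gateDepth ⟨j.val, j.isLt.trans i.isLt⟩ < C.gateDepth i := by
  conv_rhs => rw [gateDepth]
  rw [add_comm, Nat.lt_succ_iff]
  exact le_foldr_max (List.mem_map.2 ⟨_, h, rfl⟩)

theorem wireValue_pos {i : Fin C.size} (x : Fin n → ZMod 2) (v : Fin n) :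
    wireValue (i := i) x (.pos v) = literalValue x (v, 0) := by
  simp [wireValue, literalValue]

theorem wireValue_neg {i : Fin C.size} (x : Fin n → ZMod 2) (v : Fin n) :
    wireValue (i := i) x (.neg v) = literalValue x (v, 1) := by
  rw [wireValue, literalValue, CharTwo.sub_eq_add, add_comm]

/-- A gate of depth one reads literals only. -/
theorem gateValue_of_gateDepth_le_one {i : Fin C.size} (h : C.gateDepth i ≤ 1) :
    IsAffineFunction (fun x => C.gateValue x i) ∨
      IsSubcubeIndicator (fun x => C.gateValue x i) := by
  have hL : ∀ w ∈ C.inputs i, ∃ l, ∀ x, wireValue (i := i) x w = literalValue x l := by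
    intro w hw
    cases w with
    | pos v => exact ⟨_, fun x => C.wireValue_pos x v⟩
    | neg v => exact ⟨_, fun x => C.wireValue_neg x v⟩
    | gate j =>
      have h1 := C.gateDepth_lt hw
      have h2 := C.one_le_gateDepth ⟨j.val, j.isLt.trans i.isLt⟩
      omega
  choose lit hlit using hL
  have heq : ∀ x, C.gateValue x i =
      (C.kind i).eval (((C.inputs i).attach.map fun w => lit w.1 w.2).map (literalValue x)) := by
    intro x
    rw [gateValue_eq, List.map_map]
    conv_lhs => rw [← List.attach_map_subtype_val (C.inputs i), List.map_map]
    congr 1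
    exact List.map_congr_left fun w _ => hlit w.1 w.2 x
  simp only [heq]
  exact GateKind.eval_literals _ _

end ParityCircuit

/-- A literal takes each value on a hyperplane. -/
theorem containsFlat_literalValue {n k : ℕ} (hk : k < n) (l : Fin n × ZMod 2) (b : ZMod 2) :
    ContainsFlat {x : Fin n → ZMod 2 | literalValue x l = b} k := by
  refine (containsFlat_subcube {l.1} (fun _ => b + l.2) (by simpa using hk)).mono fun x hx => ?_
  have : x l.1 = b + l.2 := by simpa using hx
  rw [Set.mem_ofPred_eq, literalValue, this, add_assoc, CharTwo.add_self_eq_zero, add_zero]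

theorem IsAffineFunction.containsFlat_or_ne {n k : ℕ} (hk : k < n)
    {g : (Fin n → ZMod 2) → ZMod 2} (hg : IsAffineFunction g) (b : ZMod 2) :
    ContainsFlat {x | g x = b} k ∨ ∀ x, g x ≠ b := by
  obtain ⟨φ, a, h⟩ := hg
  by_cases hb : ∃ x₀, g x₀ = b
  · obtain ⟨x₀, rfl⟩ := hb
    refine Or.inl ((containsFlat_fiber φ x₀ (by simpa using hk)).mono fun x hx => ?_)
    have : φ x = φ x₀ := hx
    rw [Set.mem_ofPred_eq, h, h, this]
  · exact Or.inr fun x hx => hb ⟨x, hx⟩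

theorem IsSubcubeIndicator.containsFlat_or_card_le {n k : ℕ} (hk : k < n)
    {g : (Fin n → ZMod 2) → ZMod 2} (hg : IsSubcubeIndicator g) (b : ZMod 2) :
    ContainsFlat {x | g x = b} k ∨ (Finset.univ.filter fun x => g x = b).card ≤ 2 ^ k := by
  obtain ⟨T, σ, a, h⟩ := hg
  rcases zmod_two_eq_zero_or_one (b - a) with hab | hab
  · obtain rfl : b = a := sub_eq_zero.1 hab
    rcases T.eq_empty_or_nonempty with rfl | ⟨i, hi⟩
    · right
      simp [h]
    · left
      refine (containsFlat_literalValue hk (i, σ i) 1).mono fun x hx => ?_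
      have hx : x i + σ i = 1 := hx
      have : x ∉ subcube T σ := by
        intro hxT
        rw [mem_subcube.1 hxT i hi, CharTwo.add_self_eq_zero] at hx
        exact zero_ne_one hx
      simp [h, -mem_subcube, this]
  · obtain rfl : b = a + 1 := by rw [← hab]; ring
    rcases le_or_gt (k + T.card) n with hT | hT
    · refine Or.inl ((containsFlat_subcube T σ hT).mono fun x hx => ?_)
      have hx : x ∈ subcube T σ := hx
      simp [h, -mem_subcube, hx]
    · right
      have hsub : (Finset.univ.filter fun x => g x = a + 1) ⊆ subcube T σ := by
        intro x hx
        by_contra hxT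
        simp [h, -mem_subcube, hxT] at hx
      refine (Finset.card_le_card hsub).trans ?_
      have h1 := card_subcube T σ
      have h2 : 2 ^ n ≤ 2 ^ k * 2 ^ T.card := by
        rw [← pow_add]
        exact Nat.pow_le_pow_right two_pos hT.le
      rw [← h1] at h2
      exact Nat.le_of_mul_le_mul_right h2 (by positivity)

/-- An AND or OR of few depth-one gates and literals is constant on a flat of dimension `k`: either
one of its inputs takes the controlling value on such a flat, or each input takes it at few points
only, and some flat misses all of these points. -/
theorem ParityCircuit.exists_containsFlat_of_kind_ne_xor {n k : ℕ} (C : ParityCircuit n)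
    {t : Fin C.size} (ht : C.gateDepth t ≤ 2) (hK : C.kind t ≠ .xor) (hk : k < n)
    (hs : C.size * 2 ^ k < 2 ^ (n - k)) :
    ∃ b, ContainsFlat {x | C.gateValue x t = b} k := by
  classical
  obtain ⟨b, hb, hb'⟩ := GateKind.eval_of_controlling hK
  by_contra hno
  have hw : ∀ w ∈ C.inputs t, ¬ ContainsFlat {x | wireValue (i := t) x w = b} k := by
    refine fun w hw hflat => hno ⟨b, hflat.mono fun x hx => ?_⟩
    rw [Set.mem_ofPred_eq, gateValue_eq]
    exact hb _ (List.mem_map.2 ⟨w, hw, hx⟩)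
  let B : Fin C.size → Finset (Fin n → ZMod 2) := fun j =>
    if C.gateDepth j ≤ 1 ∧ ¬ ContainsFlat {x | C.gateValue x j = b} k
    then Finset.univ.filter fun x => C.gateValue x j = b else ∅
  have hB : ∀ j, (B j).card ≤ 2 ^ k := by
    intro j
    simp only [B]
    split_ifs with h
    · rcases C.gateValue_of_gateDepth_le_one h.1 with hg | hg
      · have := (hg.containsFlat_or_ne hk b).resolve_left h.2
        simp [this]
      · exact (hg.containsFlat_or_card_le hk b).resolve_left h.2
    · simp
  refine hno ⟨b + 1, (containsFlat_compl hk.le (Finset.univ.biUnion B) ?_).mono fun x hx => ?_⟩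
  · refine (Finset.card_biUnion_le.trans (Finset.sum_le_sum fun j _ => hB j)).trans_lt ?_
    simpa using hs
  · rw [Set.mem_ofPred_eq, gateValue_eq]
    refine hb' _ fun hmem => ?_
    obtain ⟨w, hwt, hwx⟩ := List.mem_map.1 hmem
    have hflat := hw w hwt
    cases w with
    | pos v =>
      simp only [C.wireValue_pos] at hflat
      exact hflat (containsFlat_literalValue hk _ b)
    | neg v =>
      simp only [C.wireValue_neg] at hflat
      exact hflat (containsFlat_literalValue hk _ b)
    | gate j =>
      refine hx (Finset.mem_biUnion.2 ⟨⟨j.val, j.isLt.trans t.isLt⟩, Finset.mem_univ _, ?_⟩)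
      have hd := C.gateDepth_lt hwt
      simp only [B]
      rw [if_pos ⟨by omega, hflat⟩]
      exact Finset.mem_filter.2 ⟨Finset.mem_univ _, hwx⟩

/-! ### Random restrictions -/

/-- The number of live variables in `T` when the live variable of block `j` is number `e j` of the
block; variable `l` of block `j` is `ι (j, l)`. -/
def liveCount {m q n : ℕ} (ι : Fin m × Fin q ↪ Fin n) (T : Finset (Fin n)) (e : Fin m → Fin q) :
    ℕ :=
  (Finset.univ.filter fun j => ι (j, e j) ∈ T).card

/-- The set of live variables, one in each block. -/
def liveSet {m q n : ℕ} (ι : Fin m × Fin q ↪ Fin n) (e : Fin m → Fin q) : Finset (Fin n) :=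
  Finset.univ.image fun j => ι (j, e j)

theorem live_injective {m q n : ℕ} (ι : Fin m × Fin q ↪ Fin n) (e : Fin m → Fin q) :
    Function.Injective fun j => ι (j, e j) :=
  fun _ _ h => congrArg Prod.fst (ι.injective h)

theorem card_sdiff_liveSet {m q n : ℕ} (ι : Fin m × Fin q ↪ Fin n) (T : Finset (Fin n))
    (e : Fin m → Fin q) : (T \ liveSet ι e).card + liveCount ι T e = T.card := by
  have : liveCount ι T e = (T ∩ liveSet ι e).card := by
    rw [liveCount, ← Finset.card_image_of_injective _ (live_injective ι e)]
    congr 1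
    ext i
    simp only [liveSet, Finset.mem_image, Finset.mem_filter, Finset.mem_univ, true_and,
      Finset.mem_inter]
    constructor
    · rintro ⟨j, hj, rfl⟩
      exact ⟨hj, j, rfl⟩
    · rintro ⟨hi, j, rfl⟩
      exact ⟨j, hi, rfl⟩
  rw [this, Finset.card_sdiff_add_card_inter]

/-- The exponential moment of the number of live variables in `T`. The blocks contribute
independent factors, and a block which meets `T` in `w` variables contributes
`q - w + 2tw ≤ q (1 + w) ≤ q 2 ^ w`. -/
theorem sum_pow_liveCount_le {m q n t : ℕ} (ι : Fin m × Fin q ↪ Fin n) (T : Finset (Fin n))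
    (hq : 2 * t ≤ q) : ∑ e, (2 * t) ^ liveCount ι T e ≤ q ^ m * 2 ^ T.card := by
  let w : Fin m → ℕ := fun j => (Finset.univ.filter fun l => ι (j, l) ∈ T).card
  have hpow : ∀ e : Fin m → Fin q,
      (2 * t) ^ liveCount ι T e = ∏ j, if ι (j, e j) ∈ T then 2 * t else 1 := by
    intro e
    rw [liveCount, ← Finset.prod_const, Finset.prod_filter]
  have hw : ∑ j, w j ≤ T.card := by
    have h1 : ∑ j, w j = (Finset.univ.filter fun x => ι x ∈ T).card := by
      simp only [w, Finset.card_filter]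
      rw [Fintype.sum_prod_type]
    rw [h1, ← Finset.card_map ι]
    refine Finset.card_le_card fun i hi => ?_
    obtain ⟨x, hx, rfl⟩ := Finset.mem_map.1 hi
    simpa using hx
  have hblock : ∀ j, (∑ l, if ι (j, l) ∈ T then 2 * t else 1) ≤ q * 2 ^ w j := by
    intro j
    have h1 : w j + 1 ≤ 2 ^ w j := Nat.lt_two_pow_self
    calc (∑ l, if ι (j, l) ∈ T then 2 * t else 1)
        ≤ ∑ l, ((if ι (j, l) ∈ T then q else 0) + 1) := by
          refine Finset.sum_le_sum fun l _ => ?_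
          split_ifs <;> omega
      _ = q * (w j + 1) := by
          rw [Finset.sum_add_distrib, ← Finset.sum_filter]
          simp [w]
          ring
      _ ≤ q * 2 ^ w j := Nat.mul_le_mul_left q h1
  calc ∑ e, (2 * t) ^ liveCount ι T e
      = ∑ e : Fin m → Fin q, ∏ j, if ι (j, e j) ∈ T then 2 * t else 1 :=
        Finset.sum_congr rfl fun e _ => hpow e
    _ = ∏ j, ∑ l, if ι (j, l) ∈ T then 2 * t else 1 := by
        rw [Finset.prod_univ_sum, Fintype.piFinset_univ]
    _ ≤ ∏ j, (q * 2 ^ w j) := Finset.prod_le_prod' fun j _ => hblock j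
    _ = q ^ m * 2 ^ ∑ j, w j := by
        rw [Finset.prod_mul_distrib, Finset.prod_pow_eq_pow_sum]
        simp
    _ ≤ q ^ m * 2 ^ T.card := Nat.mul_le_mul_left _ (Nat.pow_le_pow_right two_pos hw)

/-- The restrictions `(e, b)` (live variables given by `e`, all others fixed to the values of `b`)
after which the indicator function of `subcube T σ` still depends on at least `D` variables. -/
def badRestrictions {m q n : ℕ} (ι : Fin m × Fin q ↪ Fin n) (D : ℕ) (T : Finset (Fin n))
    (σ : Fin n → ZMod 2) : Finset ((Fin m → Fin q) × (Fin n → ZMod 2)) :=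
  {ρ | D ≤ liveCount ι T ρ.1 ∧ ρ.2 ∈ subcube (T \ liveSet ι ρ.1) σ}

/-- A random restriction is bad for a given subcube with probability at most `t ^ (-D)`. -/
theorem card_badRestrictions_mul_le {m q n t : ℕ} (ι : Fin m × Fin q ↪ Fin n) (D : ℕ)
    (T : Finset (Fin n)) (σ : Fin n → ZMod 2) (ht : 1 ≤ t) (hq : 2 * t ≤ q) :
    (badRestrictions ι D T σ).card * t ^ D ≤ q ^ m * 2 ^ n := by
  have hcard : (badRestrictions ι D T σ).card ≤
      ∑ e, if D ≤ liveCount ι T e then (subcube (T \ liveSet ι e) σ).card else 0 := by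
    rw [badRestrictions, Finset.card_filter, Fintype.sum_prod_type]
    refine Finset.sum_le_sum fun e _ => ?_
    split_ifs with h
    · simp [h, -mem_subcube]
    · simp [h]
  refine Nat.le_of_mul_le_mul_right ?_ (show 0 < 2 ^ T.card by positivity)
  calc (badRestrictions ι D T σ).card * t ^ D * 2 ^ T.card
      ≤ (∑ e, if D ≤ liveCount ι T e then (subcube (T \ liveSet ι e) σ).card else 0) *
          (t ^ D * 2 ^ T.card) := by
        rw [mul_assoc]
        exact Nat.mul_le_mul_right _ hcard
    _ = ∑ e, (if D ≤ liveCount ι T e then (subcube (T \ liveSet ι e) σ).card else 0) *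
          (t ^ D * 2 ^ T.card) := Finset.sum_mul _ _ _
    _ ≤ ∑ e, 2 ^ n * (2 * t) ^ liveCount ι T e := by
        refine Finset.sum_le_sum fun e _ => ?_
        split_ifs with h
        · rw [← card_sdiff_liveSet ι T e, pow_add, mul_pow, ← card_subcube (T \ liveSet ι e) σ]
          have := Nat.pow_le_pow_right ht h
          calc _ = (subcube (T \ liveSet ι e) σ).card * 2 ^ (T \ liveSet ι e).card *
                (2 ^ liveCount ι T e * t ^ D) := by ring
            _ ≤ _ := by gcongr
        · simp
    _ = 2 ^ n * ∑ e, (2 * t) ^ liveCount ι T e := (Finset.mul_sum _ _ _).symm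
    _ ≤ 2 ^ n * (q ^ m * 2 ^ T.card) := Nat.mul_le_mul_left _ (sum_pow_liveCount_le ι T hq)
    _ = q ^ m * 2 ^ n * 2 ^ T.card := by ring

/-- Under a restriction that is not bad, the indicator function of a subcube becomes constant or a
product of at most `d` affine functions. -/
theorem hasPolyDegree_subcube_restrict {m q n d : ℕ} (ι : Fin m × Fin q ↪ Fin n)
    (T : Finset (Fin n)) (σ : Fin n → ZMod 2) {e : Fin m → Fin q} {b : Fin n → ZMod 2}
    (h : (e, b) ∉ badRestrictions ι (d + 1) T σ) :
    HasPolyDegree d fun y =>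
      if Function.extend (fun j => ι (j, e j)) y b ∈ subcube T σ then (1 : ZMod 2) else 0 := by
  have hinj := live_injective ι e
  have hdead : ∀ y : Fin m → ZMod 2, ∀ i ∉ liveSet ι e,
      Function.extend (fun j => ι (j, e j)) y b i = b i := by
    intro y i hi
    refine Function.extend_apply' _ _ _ fun hj => hi ?_
    simpa [liveSet] using hj
  by_cases hb : b ∈ subcube (T \ liveSet ι e) σ
  · have hcount : liveCount ι T e ≤ d := by
      by_contra hlt
      exact h (by
        rw [badRestrictions, Finset.mem_filter]
        exact ⟨Finset.mem_univ _, by simpa using hlt, hb⟩)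
    have hprod : ∀ y : Fin m → ZMod 2,
        (if Function.extend (fun j => ι (j, e j)) y b ∈ subcube T σ then (1 : ZMod 2) else 0) =
          ∏ j ∈ Finset.univ.filter (fun j => ι (j, e j) ∈ T), (y j + (σ (ι (j, e j)) + 1)) := by
      intro y
      split_ifs with hy
      · refine (Finset.prod_eq_one fun j hj => ?_).symm
        have := mem_subcube.1 hy _ (Finset.mem_filter.1 hj).2
        rw [hinj.extend_apply (f := fun j => ι (j, e j)) y b j] at this
        rw [this, ← add_assoc, CharTwo.add_self_eq_zero, zero_add]
      · symm
        rw [Finset.prod_eq_zero_iff]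
        by_contra hne
        refine hy (mem_subcube.2 fun i hi => ?_)
        by_cases hlive : i ∈ liveSet ι e
        · obtain ⟨j, -, rfl⟩ := Finset.mem_image.1 hlive
          rw [hinj.extend_apply (f := fun j => ι (j, e j)) y b j]
          by_contra hyj
          refine hne ⟨j, by simpa using hi, ?_⟩
          rw [← add_assoc, CharTwo.add_eq_zero]
          exact (zmod_two_eq_zero_or_one _).resolve_left fun h0 => hyj (CharTwo.add_eq_zero.1 h0)
        · rw [hdead y i hlive]
          exact mem_subcube.1 hb i (Finset.mem_sdiff.2 ⟨hi, hlive⟩)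
    simp only [hprod]
    refine (HasPolyDegree.prod (D := fun _ => 1) _ fun j _ =>
      (HasPolyDegree.coord j).add (.const 1 _)).mono ?_
    simpa [liveCount] using hcount
  · have : ∀ y : Fin m → ZMod 2, Function.extend (fun j => ι (j, e j)) y b ∉ subcube T σ := by
      intro y hy
      refine hb (mem_subcube.2 fun i hi => ?_)
      rw [Finset.mem_sdiff] at hi
      rw [← hdead y i hi.2]
      exact mem_subcube.1 hy i hi.1
    simp only [this, if_false]
    exact .const d 0

theorem hasPolyDegree_extend_apply {n m : ℕ} {a : Fin m → Fin n} (ha : Function.Injective a)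
    (b : Fin n → ZMod 2) (i : Fin n) :
    HasPolyDegree 1 fun y : Fin m → ZMod 2 => Function.extend a y b i := by
  by_cases hi : ∃ j, a j = i
  · obtain ⟨j, rfl⟩ := hi
    simp only [ha.extend_apply]
    exact .coord j
  · simp only [Function.extend_apply' _ _ _ hi]
    exact .const 1 _

/-- Few functions of the two kinds have a common restriction under which all of them have degree at
most `d`. -/
theorem exists_restriction {s m q n t d : ℕ} (hd : 1 ≤ d) (ht : 1 ≤ t) (hq : 2 * t ≤ q)
    (hn : m * q ≤ n) (hs : s < t ^ (d + 1)) (G : Fin s → (Fin n → ZMod 2) → ZMod 2) :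
    ∃ (a : Fin m → Fin n) (b : Fin n → ZMod 2), Function.Injective a ∧
      ∀ i, IsAffineFunction (G i) ∨ IsSubcubeIndicator (G i) →
        HasPolyDegree d fun y => G i (Function.extend a y b) := by
  classical
  have ι : Fin m × Fin q ↪ Fin n := finProdFinEquiv.toEmbedding.trans (Fin.castLEEmb hn)
  let B : Fin s → Finset ((Fin m → Fin q) × (Fin n → ZMod 2)) := fun i =>
    if h : IsSubcubeIndicator (G i) then badRestrictions ι (d + 1) h.choose h.choose_spec.choose
    else ∅
  have hB : ∀ i, (B i).card * t ^ (d + 1) ≤ q ^ m * 2 ^ n := by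
    intro i
    simp only [B]
    split_ifs with h
    · exact card_badRestrictions_mul_le ι _ _ _ ht hq
    · simp
  have hlt : (Finset.univ.biUnion B).card <
      (Finset.univ : Finset ((Fin m → Fin q) × (Fin n → ZMod 2))).card := by
    have htot : (Finset.univ : Finset ((Fin m → Fin q) × (Fin n → ZMod 2))).card =
        q ^ m * 2 ^ n := by
      simp [ZMod.card]
    rw [htot]
    refine Nat.lt_of_mul_lt_mul_right (a := t ^ (d + 1)) ?_
    calc (Finset.univ.biUnion B).card * t ^ (d + 1)
        ≤ (∑ i, (B i).card) * t ^ (d + 1) := Nat.mul_le_mul_right _ Finset.card_biUnion_le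
      _ = ∑ i, (B i).card * t ^ (d + 1) := Finset.sum_mul _ _ _
      _ ≤ ∑ _i : Fin s, q ^ m * 2 ^ n := Finset.sum_le_sum fun i _ => hB i
      _ = q ^ m * 2 ^ n * s := by simp [mul_comm]
      _ < q ^ m * 2 ^ n * t ^ (d + 1) := by
        have : 0 < q := by omega
        exact Nat.mul_lt_mul_of_pos_left hs (by positivity)
  obtain ⟨⟨e, b⟩, -, hρ⟩ := Finset.exists_mem_notMem_of_card_lt_card hlt
  have hinj := live_injective ι e
  refine ⟨fun j => ι (j, e j), b, hinj, fun i hi => ?_⟩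
  by_cases h : IsSubcubeIndicator (G i)
  · have hG := h.choose_spec.choose_spec.choose_spec
    rw [show (fun y => G i (Function.extend (fun j => ι (j, e j)) y b)) = _ from
      funext fun y => hG _]
    refine (HasPolyDegree.const d _).add (hasPolyDegree_subcube_restrict ι _ _ fun hbad => hρ ?_)
    refine Finset.mem_biUnion.2 ⟨i, Finset.mem_univ _, ?_⟩
    simpa only [B, dif_pos h] using hbad
  · exact ((hi.resolve_right h).hasPolyDegree.comp
      fun i => hasPolyDegree_extend_apply hinj b i).mono hd

/-! ### Dispersers of low degree -/

/-- A small circuit of depth two which is a disperser for dimension `k` has a restriction to `m`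
variables of degree at most `d`: its output gate cannot be an AND or OR, and for an XOR it suffices
to restrict all the other gates. -/
theorem ParityCircuit.exists_restriction_hasPolyDegree {n k m q t d : ℕ} (C : ParityCircuit n)
    (hC : C.depth ≤ 2) (hdisp : IsAffineDisperser C.eval k) (hk : k < n)
    (hsize : C.size * 2 ^ k < 2 ^ (n - k)) (hd : 1 ≤ d) (ht : 1 ≤ t) (hq : 2 * t ≤ q)
    (hn : m * q ≤ n) (hs : C.size < t ^ (d + 1)) :
    ∃ (a : Fin m → Fin n) (b : Fin n → ZMod 2), Function.Injective a ∧
      HasPolyDegree d fun y => C.eval (Function.extend a y b) := by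
  obtain ⟨a, b, ha, hG⟩ := exists_restriction hd ht hq hn hs fun i x => C.gateValue x i
  refine ⟨a, b, ha, ?_⟩
  have hlit : ∀ l, HasPolyDegree d fun y => literalValue (Function.extend a y b) l := fun l =>
    ((isAffineFunction_literalValue l).hasPolyDegree.comp
      fun i => hasPolyDegree_extend_apply ha b i).mono hd
  cases hout : C.output with
  | pos v =>
    refine absurd ?_ (hdisp.not_containsFlat 0)
    have := containsFlat_literalValue hk (v, 0) 0
    simpa [eval, hout, literalValue] using this
  | neg v =>
    refine absurd ?_ (hdisp.not_containsFlat 0)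
    have := containsFlat_literalValue hk (v, 1) 0
    simpa [eval, hout, literalValue, CharTwo.sub_eq_add, add_comm] using this
  | gate i =>
    have heval : ∀ x, C.eval x = C.gateValue x i := fun x => by rw [eval, hout]
    have hdepth : C.gateDepth i ≤ 2 := by simpa [depth, hout] using hC
    have hK : C.kind i = .xor := by
      by_contra hK
      obtain ⟨c, hc⟩ := C.exists_containsFlat_of_kind_ne_xor hdepth hK hk hsize
      exact hdisp.not_containsFlat c (by simpa only [heval] using hc)
    simp only [heval, gateValue_eq, hK, GateKind.eval]
    refine HasPolyDegree.list_sum _ fun w hw => ?_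
    cases w with
    | pos v => simpa only [C.wireValue_pos] using hlit (v, 0)
    | neg v => simpa only [C.wireValue_neg] using hlit (v, 1)
    | gate j =>
      have hj := C.gateDepth_lt hw
      exact hG ⟨j.val, j.isLt.trans i.isLt⟩ (C.gateValue_of_gateDepth_le_one (by omega))

/-- A small circuit of depth two that is a disperser yields a disperser of degree at most `2c` in
`⌊√n / 5⌋` variables, for the same dimension `k`. If `k` or `2c` is large compared with the number
of variables this is trivial; otherwise the numerical conditions of the restriction argument
follow from `C.size ≤ n ^ c` alone. -/
theorem ParityCircuit.exists_polynomial_isAffineDisperser {n k : ℕ} {c : ℝ} (C : ParityCircuit n)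
    (hc : 1 ≤ c) (hC : C.depth ≤ 2) (hsize : (C.size : ℝ) ≤ (n : ℝ) ^ c)
    (hdisp : IsAffineDisperser C.eval k) :
    ∃ p : MvPolynomial (Fin (Nat.sqrt n / 5)) (ZMod 2), p.totalDegree ≤ ⌊2 * c⌋₊ ∧
      IsAffineDisperser (fun x => MvPolynomial.eval x p) k := by
  set r := Nat.sqrt n with hr
  set d := ⌊2 * c⌋₊ with hd
  have hrn : r * r ≤ n := Nat.sqrt_le n
  have hnr : n < (r + 1) * (r + 1) := Nat.lt_succ_sqrt n
  suffices h : k ≤ r / 5 → ∃ (a : Fin (r / 5) → Fin n) (b : Fin n → ZMod 2),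
      Function.Injective a ∧ HasPolyDegree d fun y => C.eval (Function.extend a y b) by
    rcases le_or_gt k (r / 5) with hk | hk
    · obtain ⟨a, b, ha, p, hp, hpe⟩ := h hk
      refine ⟨p, hp, ?_⟩
      simp only [hpe]
      exact hdisp.extend ha b
    · exact ⟨0, by simp, .of_lt hk _⟩
  intro hk
  have hmn : r / 5 ≤ n := by nlinarith [Nat.div_le_self r 5, Nat.le_mul_self r]
  rcases le_or_gt (r / 5) d with hmd | hmd
  -- In this case any restriction to `r / 5` variables will do.
  · exact ⟨Fin.castLE hmn, 0, Fin.castLE_injective hmn, (hasPolyDegree_card _).mono hmd⟩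
  have hd2 : 2 ≤ d := Nat.le_floor (by push_cast; linarith)
  have hr15 : 15 ≤ r := by omega
  have hs : C.size < (r + 1) ^ (d + 1) := by
    have h1 : (C.size : ℝ) < ((r : ℝ) + 1) ^ (d + 1) := by
      calc (C.size : ℝ) ≤ (n : ℝ) ^ c := hsize
        _ ≤ (((r : ℝ) + 1) ^ (2 : ℝ)) ^ c := by
          refine Real.rpow_le_rpow (by positivity) ?_ (by linarith)
          rw [Real.rpow_two, sq]
          exact_mod_cast hnr.le
        _ = ((r : ℝ) + 1) ^ (2 * c) := (Real.rpow_mul (by positivity) _ _).symm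
        _ < ((r : ℝ) + 1) ^ ((d + 1 : ℕ) : ℝ) := by
          refine Real.rpow_lt_rpow_of_exponent_lt ?_ ?_
          · have : (15 : ℝ) ≤ r := by exact_mod_cast hr15
            linarith
          · push_cast
            exact Nat.lt_floor_add_one _
        _ = ((r : ℝ) + 1) ^ (d + 1) := Real.rpow_natCast _ _
    exact_mod_cast h1
  have h5 : 5 * (r / 5) ≤ r := Nat.mul_div_le r 5
  have hmr : 5 * (r * (r / 5)) ≤ n := by nlinarith
  refine C.exists_restriction_hasPolyDegree hC hdisp (t := r + 1) (q := 2 * (r + 1))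
    (by nlinarith) ?_ (by omega) (by omega) le_rfl (by nlinarith) hs
  have h2 : C.size < 2 ^ (r * (r / 5)) := by
    calc C.size < (r + 1) ^ (d + 1) := hs
      _ ≤ (r + 1) ^ (r / 5) := Nat.pow_le_pow_right (by omega) hmd
      _ ≤ (2 ^ r) ^ (r / 5) := Nat.pow_le_pow_left Nat.lt_two_pow_self _
      _ = 2 ^ (r * (r / 5)) := (pow_mul _ _ _).symm
  calc C.size * 2 ^ k < 2 ^ (r * (r / 5)) * 2 ^ k := by gcongr
    _ = 2 ^ (r * (r / 5) + k) := (pow_add _ _ _).symm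
    _ ≤ 2 ^ (n - k) := by
      refine Nat.pow_le_pow_right two_pos ?_
      have : k ≤ r * (r / 5) := by nlinarith
      omega

/-- With `m = ⌊√n / 5⌋ ≥ √n / 10` and `d = ⌊2c⌋`, the bound `m ^ (1 / d) / 4` is at least
`(√n / 10) ^ (1 / (2c)) / 4`, and `10 ^ (1 / (2c)) ≤ 10`. -/
theorem rpow_le_maxConstDim_sqrt {n : ℕ} (hn : 100 ≤ n) {c : ℝ} (hc : 1 ≤ c) :
    1 / 40 * (n : ℝ) ^ (1 / (4 * c)) ≤
      (maxConstDim (ZMod 2) ⌊√(n : ℝ) / 5⌋₊ ⌊2 * c⌋₊ : ℝ) := by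
  have hn' : (100 : ℝ) ≤ n := by exact_mod_cast hn
  have hs : (10 : ℝ) ≤ √n := by
    rw [Real.le_sqrt (by norm_num) (by positivity)]
    linarith
  set m := ⌊√(n : ℝ) / 5⌋₊ with hm
  set d := ⌊2 * c⌋₊ with hd
  have hm2 : 2 ≤ m := Nat.le_floor (by push_cast; linarith)
  have hd2 : 2 ≤ d := Nat.le_floor (by push_cast; linarith)
  have hdc : (d : ℝ) ≤ 2 * c := Nat.floor_le (by linarith)
  have hd0 : (2 : ℝ) ≤ d := by exact_mod_cast hd2
  have hm1 : (1 : ℝ) ≤ m := by exact_mod_cast (by omega : 1 ≤ m)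
  have hmn : √n / 10 ≤ m := by
    have := Nat.lt_floor_add_one (√(n : ℝ) / 5)
    rw [← hm] at this
    linarith
  have h1 : (√n / 10) ^ (1 / (2 * c)) ≤ (m : ℝ) ^ (1 / (d : ℝ)) :=
    calc (√n / 10) ^ (1 / (2 * c)) ≤ (m : ℝ) ^ (1 / (2 * c)) :=
          Real.rpow_le_rpow (by positivity) hmn (by positivity)
      _ ≤ (m : ℝ) ^ (1 / (d : ℝ)) :=
          Real.rpow_le_rpow_of_exponent_le hm1
            (one_div_le_one_div_of_le (by linarith) hdc)
  have h2 : (n : ℝ) ^ (1 / (4 * c)) / 10 ≤ (√n / 10) ^ (1 / (2 * c)) := by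
    rw [Real.div_rpow (by positivity) (by positivity), Real.sqrt_eq_rpow,
      ← Real.rpow_mul (by positivity)]
    have he : 1 / 2 * (1 / (2 * c)) = 1 / (4 * c) := by
      field_simp
      norm_num
    rw [he]
    refine div_le_div_of_nonneg_left (by positivity) (by positivity) ?_
    calc (10 : ℝ) ^ (1 / (2 * c)) ≤ 10 ^ (1 : ℝ) := by
          refine Real.rpow_le_rpow_of_exponent_le (by norm_num) ?_
          rw [div_le_one (by linarith)]
          linarith
      _ = 10 := Real.rpow_one _
  have h3 := rpow_le_maxConstDim (m := m) (d := d) (by omega) hm2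
  linarith

theorem theorem8 :
    (∀ (n k : ℕ) (c : ℝ) (C : ParityCircuit n), 1 ≤ c → C.depth ≤ 2 →
      (C.size : ℝ) ≤ (n : ℝ) ^ c → IsAffineDisperser C.eval k →
        ((k : ℝ) < (n : ℝ) / 10 - c * Real.logb 2 (n : ℝ) →
          ∃ p : MvPolynomial (Fin ⌊√(n : ℝ) / 5⌋₊) (ZMod 2), (p.totalDegree : ℝ) ≤ 2 * c ∧
            IsAffineDisperser (fun x => MvPolynomial.eval x p) k) ∧
        maxConstDim (ZMod 2) ⌊√(n : ℝ) / 5⌋₊ ⌊2 * c⌋₊ < k) ∧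
    (∃ δ : ℝ, 0 < δ ∧ ∃ n₀ : ℕ, ∀ n : ℕ, n₀ ≤ n → ∀ c : ℝ, 1 ≤ c →
      δ * (n : ℝ) ^ (1 / (4 * c)) ≤ (maxConstDim (ZMod 2) ⌊√(n : ℝ) / 5⌋₊ ⌊2 * c⌋₊ : ℝ)) := by
  refine ⟨fun n k c C hc hC hsize hdisp => ?_,
    1 / 40, by norm_num, 100, fun n hn c hc => rpow_le_maxConstDim_sqrt hn hc⟩
  have hm : ⌊√(n : ℝ) / 5⌋₊ = Nat.sqrt n / 5 := by
    rw [← Real.nat_floor_real_sqrt_eq_nat_sqrt]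
    exact Nat.floor_div_ofNat _ _
  rw [hm]
  obtain ⟨p, hp, hpdisp⟩ := C.exists_polynomial_isAffineDisperser hc hC hsize hdisp
  refine ⟨fun _ => ⟨p, (Nat.le_floor_iff (by linarith)).1 hp, hpdisp⟩, ?_⟩
  by_contra! hle
  -- Every polynomial is constant on a flat of the maximal dimension, hence on one of dimension `k`.
  obtain ⟨u₀, U, hU, b, hb⟩ :=
    (maxConstDim_isGreatest (ZMod 2) (Nat.sqrt n / 5) ⌊2 * c⌋₊).1 p hp
  obtain ⟨U', hU', hk⟩ := exists_submodule_le_finrank_eq U (hle.trans_eq hU.symm)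
  exact hpdisp u₀ U' hk ⟨b, fun u hu => hb u (hU' hu)⟩
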